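/- A $k$-player game $\mathcal G=(\mathcal X,\mathcal A,Q,V)$ consists of finite sets $\mathcal X=\mathcal X^1\times\dots\times\mathcal X^k$ (questions) and $\mathcal A=\mathcal A^1\times\dots\times\mathcal A^k$ (answers), a probability distribution $Q$ on $\mathcal X$, and a predicate $V:\mathcal X\times\mathcal A\to\{0,1\}$. Its value is $$\mathrm{val}(\mathcal G)=\max_{f^1,\dots,f^k}\Pr_{x\sim Q}\bigl[V\bigl((x^1,\dots,x^k),(f^1(x^1),\dots,f^k(x^k))\bigr)=1\bigr],$$ where the maximum is over all functions $f^j:\mathcal X^j\to\mathcal A^j$, $1\le j\le k$. The $n$-fold parallel repetition $\mathcal G^{\otimes n}$ is the $k$-player game in which $n$ question vectors $x_1,\dots,x_n\in\mathcal X$ are drawn independently from $Q$, player $j$ receives $(x_1^j,\dots,x_n^j)\in(\mathcal X^j)^n$ and answers with $(a_1^j,\dots,a_n^j)\in(\mathcal A^j)^n$, and the players win if and only if $V(x_i,a_i)=1$ for every $i\in\{1,\dots,n\}$. For each player $j$, let $H^j_{\mathcal G}$ be the graph with vertex set $\mathcal X^j$ in which two distinct questions $x^j,y^j$ are adjacent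 if and only if there is a vector $z$ of questions for the other players such that both $(z,x^j)$ and $(z,y^j)$ have positive probability under $Q$. The game is called playerwise connected if $H^j_{\mathcal G}$ is connected for every $j\in\{1,\dots,k\}$ (in particular, every question of every player is then asked with positive probability). **Theorem.** Let $\mathcal G$ be a playerwise connected $k$-player game (with any number $k$ of players and any finite question and answer sets) such that $\mathrm{val}(\mathcal G)<1$. Then there exists a constant $c=c(\mathcal G)>0$ such that for every integer $n\ge 1$, $$\mathrm{val}(\mathcal G^{\otimes n})\le n^{-c}.$$ -/

import Mathlib

universe u v

/-- A `k`-player game with finite question sets `X j` and answer sets `A j` (`j : Fin k`):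
a probability distribution `Q` on the question vectors, and a `{0,1}`-valued predicate `V` on
pairs of a question vector and an answer vector. -/
structure MultiplayerGame (k : ℕ) (X : Fin k → Type u) (A : Fin k → Type v)
    [∀ j, Fintype (X j)] where
  /-- the query distribution -/
  Q : (∀ j, X j) → ℝ
  Q_nonneg : ∀ x, 0 ≤ Q x
  Q_sum : ∑ x, Q x = 1
  /-- the winning predicate -/
  V : (∀ j, X j) → (∀ j, A j) → Bool

namespace MultiplayerGame

variable {k : ℕ} {X : Fin k → Type u} {A : Fin k → Type v} [∀ j, Fintype (X j)]

/-- The probability, over `x ∼ Q`, that the players win when player `j` answers its own question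
`x j` by `f j (x j)`. -/
noncomputable def winProb (G : MultiplayerGame k X A) (f : ∀ j, X j → A j) : ℝ :=
  ∑ x, if G.V x (fun j => f j (x j)) = true then G.Q x else 0

/-- The value of the game: the maximum winning probability over all product strategies. -/
noncomputable def value (G : MultiplayerGame k X A) : ℝ :=
  ⨆ f : (∀ j, X j → A j), G.winProb f

/-- The supremum defining the value is an upper bound for all winning probabilities and is
attained, so it is a maximum. -/
theorem isGreatest_value [∀ j, Finite (A j)] [∀ j, Nonempty (A j)] (G : MultiplayerGame k X A) :
    IsGreatest (Set.range G.winProb) G.value :=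
  ⟨exists_eq_ciSup_of_finite (f := G.winProb), by
    rintro _ ⟨f, rfl⟩
    exact le_ciSup (f := G.winProb) (Set.finite_range _).bddAbove f⟩

/-- A product distribution sums to one. -/
theorem sum_prod_Q (G : MultiplayerGame k X A) (n : ℕ) :
    ∑ x : (∀ j, Fin n → X j), ∏ i, G.Q (fun j => x j i) = 1 := by
  have h : ∑ x : (∀ j, Fin n → X j), ∏ i, G.Q (fun j => x j i) =
      ∑ y : (Fin n → ∀ j, X j), ∏ i, G.Q (y i) :=
    Fintype.sum_equiv (Equiv.piComm fun (j : Fin k) (_ : Fin n) => X j) _ _ (fun _ => rfl)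
  rw [h, ← Fintype.piFinset_univ, Finset.sum_prod_piFinset]
  simp [G.Q_sum]

/-- The `n`-fold parallel repetition. Player `j` receives `n` questions and gives `n` answers, the
`n` question vectors are independent samples from `Q`, and the players win if and only if they win
in each of the `n` coordinates. -/
noncomputable def parallelRep (G : MultiplayerGame k X A) (n : ℕ) :
    MultiplayerGame k (fun j => Fin n → X j) (fun j => Fin n → A j) where
  Q x := ∏ i, G.Q (fun j => x j i)
  Q_nonneg _ := Finset.prod_nonneg fun _ _ => G.Q_nonneg _
  Q_sum := G.sum_prod_Q n
  V x a := decide (∀ i, G.V (fun j => x j i) (fun j => a j i) = true)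

/-- The support of the query distribution. -/
def support (G : MultiplayerGame k X A) : Set (∀ j, X j) := {x | 0 < G.Q x}

/-- The graph of player `j`: the vertices are the questions of player `j`, and two distinct
questions are adjacent if some choice of questions to the other players completes both to question
vectors in the support of `Q`. (The `j`-th entry of `z` is overwritten, hence irrelevant.) -/
def playerGraph (G : MultiplayerGame k X A) (j : Fin k) : SimpleGraph (X j) where
  Adj x y := x ≠ y ∧ ∃ z : (∀ i, X i),
    Function.update z j x ∈ G.support ∧ Function.update z j y ∈ G.support
  symm := ⟨fun _ _ ⟨h, z, hx, hy⟩ => ⟨h.symm, z, hy, hx⟩⟩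
  loopless := ⟨fun _ h => h.1 rfl⟩

/-- A game is playerwise connected if the graph of every player is connected. (Then every question
of every player is asked with positive probability.) -/
def PlayerwiseConnected (G : MultiplayerGame k X A) : Prop :=
  ∀ j, (G.playerGraph j).Connected

end MultiplayerGame

/-! Parallel repetition fails to multiply values because conditioning on winning some coordinates
may correlate the question in another coordinate with a player's other questions. The proof shows
that on a product event this correlation averages out over the coordinates.

Write `Q` as a mixture of product distributions (`QueryDecomposition`) and fix the mixture component
`r l` of every coordinate. The players' questions outside coordinate `i` are then independent across
players, so each player can sample them privately and play `G` in coordinate `i`. Restricted to a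
product event `∏ j, E j (x j)`, player `j` asked `a` has an unnormalised strategy, whose mass is the
sum of `slice`. If these masses hardly depend on `a`, normalising costs a constant factor and
coordinate `i` is lost on a constant fraction of the event (`mul_sub_defect_le_sum_loss`).

By connectivity it suffices to compare masses at adjacent questions. The mixture of
`edgeDecomposition` gives every edge of a player graph its own component, so the difference of two
adjacent masses is a correlation of `E j` with a bounded centred function of coordinate `i`. A
second moment bound makes `n` such correlations add up to only `O(√n)` (`sum_abs_sub_le`).

Winning on a set `S` is a disjoint union of product events, one for each winning transcript on `S`.
Hence some coordinate lowers the winning probability by a constant factor, up to an error `O(N ^ |S|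
/ √n)`. Iterating about `log n` times gives polynomial decay. -/

open Finset

/-! ### Sums over finite product spaces -/

/-- A sum over a product space of a product of one-coordinate functions factors. -/
theorem sum_pi_prod {ι : Type*} [Fintype ι] [DecidableEq ι] {B : ι → Type*} [∀ i, Fintype (B i)]
    (g : ∀ i, B i → ℝ) : ∑ f : (∀ i, B i), ∏ i, g i (f i) = ∏ i, ∑ b, g i b := by
  rw [Finset.prod_univ_sum, Fintype.piFinset_univ]

theorem prod_univ_eq_mul_prod_erase {ι : Type*} [Fintype ι] [DecidableEq ι] (i : ι) (g : ι → ℝ) :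
    ∏ l, g l = g i * ∏ l ∈ univ.erase i, g l :=
  (Finset.mul_prod_erase univ g (mem_univ i)).symm

/-- Under a product distribution, a function of the `i`-th coordinate is independent of a function
of the other coordinates. -/
theorem sum_pi_indep {ι Y : Type*} [Fintype ι] [DecidableEq ι] [Fintype Y]
    (p : Y → ℝ) (hp : ∑ y, p y = 1) (i : ι) (u : Y → ℝ) (g : (ι → Y) → ℝ)
    (hg : ∀ r y, g (Function.update r i y) = g r) :
    ∑ r : ι → Y, (∏ l, p (r l)) * (u (r i) * g r) =
      (∑ y, p y * u y) * ∑ r : ι → Y, (∏ l, p (r l)) * g r := by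
  -- The involution exchanging the `i`-th coordinate with an independent copy preserves the product
  -- measure, and `g` does not notice it.
  let e : (ι → Y) × Y ≃ (ι → Y) × Y :=
    { toFun := fun q => (Function.update q.1 i q.2, q.1 i)
      invFun := fun q => (Function.update q.1 i q.2, q.1 i)
      left_inv := fun q => by simp
      right_inv := fun q => by simp }
  have h1 : ∑ r : ι → Y, (∏ l, p (r l)) * (u (r i) * g r) =
      ∑ q : (ι → Y) × Y, (∏ l, p (q.1 l)) * (u (q.1 i) * g q.1) * p q.2 := by
    rw [Fintype.sum_prod_type]
    refine Finset.sum_congr rfl fun r _ => ?_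
    dsimp only
    rw [← Finset.mul_sum, hp, mul_one]
  have h2 : (∑ y, p y * u y) * ∑ r : ι → Y, (∏ l, p (r l)) * g r =
      ∑ q : (ι → Y) × Y, (∏ l, p (q.1 l)) * g q.1 * (p q.2 * u q.2) := by
    rw [Fintype.sum_prod_type, Finset.mul_sum]
    refine Finset.sum_congr rfl fun r _ => ?_
    dsimp only
    rw [← Finset.mul_sum, mul_comm]
  rw [h1, h2, ← Equiv.sum_comp e]
  refine Finset.sum_congr rfl fun q _ => ?_
  have h3 : ∏ l ∈ univ.erase i, p (Function.update q.1 i q.2 l) =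
      ∏ l ∈ univ.erase i, p (q.1 l) :=
    Finset.prod_congr rfl fun l hl => by rw [Function.update_of_ne (Finset.ne_of_mem_erase hl)]
  change (∏ l, p (Function.update q.1 i q.2 l)) *
    (u (Function.update q.1 i q.2 i) * g (Function.update q.1 i q.2)) * p (q.1 i) = _
  rw [hg, prod_univ_eq_mul_prod_erase i, h3, prod_univ_eq_mul_prod_erase i (fun l => p (q.1 l)),
    Function.update_self]
  ring

/-- The second moment of a linear combination of independent centred functions bounded by `C`. -/
theorem sum_pi_sq_le {ι B : Type*} [Fintype ι] [DecidableEq ι] [Fintype B]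
    (p : ι → B → ℝ) (hp0 : ∀ i b, 0 ≤ p i b) (hp : ∀ i, ∑ b, p i b = 1)
    (w : ι → B → ℝ) (hw : ∀ i, ∑ b, p i b * w i b = 0) (C : ℝ)
    (hC : ∀ i b, w i b ^ 2 ≤ C) :
    ∑ x : ι → B, (∏ l, p l (x l)) * (∑ i, w i (x i)) ^ 2 ≤ Fintype.card ι * C := by
  have h1 : ∀ i i', i ≠ i' →
      ∑ x : ι → B, (∏ l, p l (x l)) * (w i (x i) * w i' (x i')) = 0 := by
    intro i i' hii
    -- As a product over coordinates, the cross term has the mean of `w i` as its factor at `i`,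
    -- which vanishes.
    have : ∀ x : ι → B, (∏ l, p l (x l)) * (w i (x i) * w i' (x i')) =
        ∏ l, (p l (x l) * ((if l = i then w l (x l) else 1) *
          (if l = i' then w l (x l) else 1))) := by
      intro x
      rw [Finset.prod_mul_distrib, Finset.prod_mul_distrib]
      simp
    rw [Finset.sum_congr rfl fun x _ => this x,
      sum_pi_prod (fun l b => p l b * ((if l = i then w l b else 1) *
        (if l = i' then w l b else 1)))]
    refine Finset.prod_eq_zero (mem_univ i) ?_
    simp [hii, hw]
  have h2 : ∀ i, ∑ x : ι → B, (∏ l, p l (x l)) * (w i (x i) * w i (x i)) ≤ C := by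
    intro i
    calc _ ≤ ∑ x : ι → B, (∏ l, p l (x l)) * C := by
          refine Finset.sum_le_sum fun x _ => mul_le_mul_of_nonneg_left ?_
            (Finset.prod_nonneg fun _ _ => hp0 _ _)
          rw [← sq]; exact hC _ _
      _ = C := by rw [← Finset.sum_mul, sum_pi_prod]; simp [hp]
  have h3 : ∑ x : ι → B, (∏ l, p l (x l)) * (∑ i, w i (x i)) ^ 2 =
      ∑ i, ∑ i', ∑ x : ι → B, (∏ l, p l (x l)) * (w i (x i) * w i' (x i')) := by
    simp_rw [sq, Finset.sum_mul_sum, Finset.mul_sum]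
    rw [Finset.sum_comm]
    exact Finset.sum_congr rfl fun i _ => Finset.sum_comm
  rw [h3]
  calc _ ≤ ∑ _i : ι, C := Finset.sum_le_sum fun i _ => by
        rw [Finset.sum_eq_single i (fun i' _ h => h1 i i' h.symm) (by simp)]
        exact h2 i
    _ = _ := by simp

/-! ### Private randomised strategies -/

namespace MultiplayerGame

variable {k : ℕ} {X : Fin k → Type u} {A : Fin k → Type v} [∀ j, Fintype (X j)]

/-- The indicator of losing on questions `q` with answers `α`. -/
noncomputable def loss (G : MultiplayerGame k X A) (q : ∀ j, X j) (α : ∀ j, A j) : ℝ :=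
  if G.V q α = true then 0 else 1

theorem loss_nonneg (G : MultiplayerGame k X A) (q : ∀ j, X j) (α : ∀ j, A j) :
    0 ≤ G.loss q α := by
  unfold loss; split_ifs <;> norm_num

theorem one_sub_value_le_sum_loss [∀ j, Fintype (A j)] (G : MultiplayerGame k X A)
    (f : ∀ j, X j → A j) :
    1 - G.value ≤ ∑ q, G.Q q * G.loss q (fun j => f j (q j)) := by
  have h1 : G.winProb f ≤ G.value := le_ciSup (f := G.winProb) (Set.finite_range _).bddAbove f
  have h2 : ∑ q, G.Q q * G.loss q (fun j => f j (q j)) = 1 - G.winProb f := by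
    rw [← G.Q_sum, winProb, ← Finset.sum_sub_distrib]
    refine Finset.sum_congr rfl fun q _ => ?_
    unfold loss; split_ifs <;> simp
  linarith

theorem value_nonneg (G : MultiplayerGame k X A) : 0 ≤ G.value :=
  Real.iSup_nonneg fun _ => Finset.sum_nonneg fun _ _ => by
    split_ifs
    · exact G.Q_nonneg _
    · exact le_rfl

/-- Independent private randomness does not help: randomised strategies, given by kernels `σ`. -/
theorem one_sub_value_le_sum_kernel [∀ j, Fintype (A j)] (G : MultiplayerGame k X A)
    {B : Fin k → Type*} [∀ j, Fintype (B j)] (F : ∀ j, B j → A j)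
    (σ : ∀ j, X j → B j → ℝ) (h0 : ∀ j a b, 0 ≤ σ j a b) (h1 : ∀ j a, ∑ b, σ j a b = 1) :
    1 - G.value ≤ ∑ q, G.Q q * ∑ β : (∀ j, B j),
      (∏ j, σ j (q j) (β j)) * G.loss q (fun j => F j (β j)) := by
  classical
  -- The kernels are realised by response tables `s j` drawn in advance with independent entries,
  -- which exhibits the randomised strategy as an average of deterministic ones.
  have hW : ∑ s : (∀ j, X j → B j), ∏ j, ∏ a, σ j a (s j a) = 1 := by
    rw [sum_pi_prod (fun j (s : X j → B j) => ∏ a, σ j a (s a))]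
    simp [sum_pi_prod, h1]
  have hM : ∀ (q : ∀ j, X j) (h : (∀ j, B j) → ℝ),
      ∑ s : (∀ j, X j → B j), (∏ j, ∏ a, σ j a (s j a)) * h (fun j => s j (q j)) =
        ∑ β, (∏ j, σ j (q j) (β j)) * h β := by
    intro q h
    have e1 : ∀ β : (∀ j, B j), ∑ s : (∀ j, X j → B j), ∏ j, ∏ a, (σ j a (s j a) *
        (if a = q j then (if s j a = β j then 1 else 0) else 1)) = ∏ j, σ j (q j) (β j) := by
      intro β
      rw [sum_pi_prod (fun j (s : X j → B j) => ∏ a, (σ j a (s a) *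
        (if a = q j then (if s a = β j then 1 else 0) else 1)))]
      refine Finset.prod_congr rfl fun j _ => ?_
      rw [sum_pi_prod (fun a b => σ j a b * (if a = q j then (if b = β j then 1 else 0) else 1)),
        Finset.prod_eq_single (q j)]
      · simp
      · intro a _ ha
        simp [ha, h1]
      · simp
    have e2 : ∀ s : (∀ j, X j → B j), (∏ j, ∏ a, σ j a (s j a)) * h (fun j => s j (q j)) =
        ∑ β : (∀ j, B j), (∏ j, ∏ a, (σ j a (s j a) *
          (if a = q j then (if s j a = β j then 1 else 0) else 1))) * h β := by
      intro s
      rw [Finset.sum_eq_single (fun j => s j (q j))]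
      · congr 1
        refine Finset.prod_congr rfl fun j _ => Finset.prod_congr rfl fun a _ => ?_
        by_cases ha : a = q j
        · subst ha; simp
        · simp [ha]
      · intro β _ hβ
        obtain ⟨j, hj⟩ := Function.ne_iff.1 hβ
        rw [Finset.prod_eq_zero (mem_univ j), zero_mul]
        refine Finset.prod_eq_zero (mem_univ (q j)) ?_
        simp [Ne.symm hj]
      · simp
    rw [Finset.sum_congr rfl fun s _ => e2 s, Finset.sum_comm]
    refine Finset.sum_congr rfl fun β _ => ?_
    rw [← Finset.sum_mul, e1]
  calc 1 - G.value = ∑ s : (∀ j, X j → B j), (∏ j, ∏ a, σ j a (s j a)) * (1 - G.value) := by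
        rw [← Finset.sum_mul, hW, one_mul]
    _ ≤ ∑ s : (∀ j, X j → B j), (∏ j, ∏ a, σ j a (s j a)) *
          ∑ q, G.Q q * G.loss q (fun j => F j (s j (q j))) :=
        Finset.sum_le_sum fun s _ => mul_le_mul_of_nonneg_left
          (G.one_sub_value_le_sum_loss fun j a => F j (s j a))
          (Finset.prod_nonneg fun _ _ => Finset.prod_nonneg fun _ _ => h0 _ _ _)
    _ = _ := by
        simp_rw [Finset.mul_sum]
        rw [Finset.sum_comm]
        refine Finset.sum_congr rfl fun q _ => ?_
        rw [← Finset.mul_sum, ← hM q (fun β => G.loss q (fun j => F j (β j))), Finset.mul_sum]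
        exact Finset.sum_congr rfl fun s _ => by ring

/-- Dividing each `τ j a` by its mass yields genuine kernels. Since `t j` is at most that mass,
multiplying the normalised loss by `∏ j, t j` cannot exceed the unnormalised loss. -/
theorem mul_prod_le_sum_kernel [∀ j, Fintype (A j)] (G : MultiplayerGame k X A)
    {B : Fin k → Type*} [∀ j, Fintype (B j)] (F : ∀ j, B j → A j)
    (τ : ∀ j, X j → B j → ℝ) (h0 : ∀ j a b, 0 ≤ τ j a b) (t : Fin k → ℝ) (ht : ∀ j, 0 ≤ t j)
    (h1 : ∀ j a, t j ≤ ∑ b, τ j a b) :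
    (1 - G.value) * ∏ j, t j ≤ ∑ q, G.Q q * ∑ β : (∀ j, B j),
      (∏ j, τ j (q j) (β j)) * G.loss q (fun j => F j (β j)) := by
  by_cases hz : ∃ j, t j = 0
  · obtain ⟨j, hj⟩ := hz
    rw [Finset.prod_eq_zero (mem_univ j) hj, mul_zero]
    exact Finset.sum_nonneg fun q _ => mul_nonneg (G.Q_nonneg _) <|
      Finset.sum_nonneg fun β _ => mul_nonneg (Finset.prod_nonneg fun _ _ => h0 _ _ _)
        (G.loss_nonneg _ _)
  push Not at hz
  have htp : ∀ j, 0 < t j := fun j => lt_of_le_of_ne (ht j) (hz j).symm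
  have hΦ : ∀ j a, 0 < ∑ b, τ j a b := fun j a => (htp j).trans_le (h1 j a)
  have key := G.one_sub_value_le_sum_kernel F (fun j a b => τ j a b / ∑ b, τ j a b)
    (fun j a b => div_nonneg (h0 j a b) (hΦ j a).le)
    (fun j a => by rw [← Finset.sum_div, div_self (hΦ j a).ne'])
  calc _ ≤ (∑ q, G.Q q * ∑ β : (∀ j, B j), (∏ j, τ j (q j) (β j) / ∑ b, τ j (q j) b) *
        G.loss q (fun j => F j (β j))) * ∏ j, t j :=
        mul_le_mul_of_nonneg_right key (Finset.prod_nonneg fun j _ => ht j)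
    _ ≤ _ := by
        rw [Finset.sum_mul]
        refine Finset.sum_le_sum fun q _ => ?_
        rw [mul_assoc]
        refine mul_le_mul_of_nonneg_left ?_ (G.Q_nonneg q)
        rw [Finset.sum_mul]
        refine Finset.sum_le_sum fun β _ => ?_
        rw [mul_right_comm, ← Finset.prod_mul_distrib]
        refine mul_le_mul_of_nonneg_right ?_ (G.loss_nonneg _ _)
        refine Finset.prod_le_prod (fun j _ => mul_nonneg (div_nonneg (h0 _ _ _) (hΦ _ _).le)
          (ht j)) fun j _ => ?_
        rw [div_mul_eq_mul_div, div_le_iff₀ (hΦ _ _)]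
        exact mul_le_mul_of_nonneg_left (h1 _ _) (h0 _ _ _)

end MultiplayerGame

/-! ### Nearly constant masses on connected player graphs -/

theorem SimpleGraph.Connected.abs_sub_le {V : Type*} [Fintype V] {H : SimpleGraph V}
    (hH : H.Connected) (f : V → ℝ) {D : ℝ} (hD : ∀ a b, H.Adj a b → |f a - f b| ≤ D)
    (hD0 : 0 ≤ D) (a b : V) : |f a - f b| ≤ Fintype.card V * D := by
  have hwalk : ∀ {a b : V} (p : H.Walk a b), |f a - f b| ≤ p.length * D := by
    intro a b p
    induction p with
    | nil => simp
    | @cons a c b h p ih =>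
      calc |f a - f b| ≤ |f a - f c| + |f c - f b| := _root_.abs_sub_le _ _ _
        _ ≤ D + p.length * D := add_le_add (hD _ _ h) ih
        _ = _ := by rw [SimpleGraph.Walk.length_cons]; push_cast; ring
  -- A path repeats no vertex, so it has fewer than `Fintype.card V` edges.
  obtain ⟨p, hp⟩ := (hH.preconnected a b).exists_isPath
  exact (hwalk p).trans <| mul_le_mul_of_nonneg_right (by exact_mod_cast hp.length_lt.le) hD0

namespace MultiplayerGame

variable {k : ℕ} {X : Fin k → Type u} {A : Fin k → Type v} [∀ j, Fintype (X j)]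

open Classical in
/-- The total variation of a function on the questions of player `j` along the edges of its
graph. -/
noncomputable def edgeVariation (G : MultiplayerGame k X A) (j : Fin k) (f : X j → ℝ) : ℝ :=
  ∑ a, ∑ b, if (G.playerGraph j).Adj a b then |f a - f b| else 0

theorem edgeVariation_nonneg (G : MultiplayerGame k X A) (j : Fin k) (f : X j → ℝ) :
    0 ≤ G.edgeVariation j f :=
  Finset.sum_nonneg fun _ _ => Finset.sum_nonneg fun _ _ => by
    split_ifs
    · exact abs_nonneg _
    · exact le_rfl

theorem abs_sub_le_edgeVariation (G : MultiplayerGame k X A) (j : Fin k) (f : X j → ℝ) {a b : X j}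
    (h : (G.playerGraph j).Adj a b) : |f a - f b| ≤ G.edgeVariation j f := by
  classical
  have h0 : ∀ a b : X j, 0 ≤ if (G.playerGraph j).Adj a b then |f a - f b| else 0 := by
    intro a b
    split_ifs
    · exact abs_nonneg _
    · exact le_rfl
  unfold edgeVariation
  calc |f a - f b| = if (G.playerGraph j).Adj a b then |f a - f b| else 0 := by rw [if_pos h]
    _ ≤ ∑ b, if (G.playerGraph j).Adj a b then |f a - f b| else 0 :=
        Finset.single_le_sum (f := fun b => if (G.playerGraph j).Adj a b then |f a - f b| else 0)
          (fun b _ => h0 a b) (mem_univ b)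
    _ ≤ _ := by
        convert Finset.single_le_sum
          (f := fun a => ∑ b, if (G.playerGraph j).Adj a b then |f a - f b| else 0)
          (fun a _ => Finset.sum_nonneg fun b _ => h0 a b) (mem_univ a)

/-- The total defect of the masses `f j : X j → ℝ`, which controls how far they are from being
constant. -/
noncomputable def defect (G : MultiplayerGame k X A) (f : ∀ j, X j → ℝ) : ℝ :=
  2 * ∑ j, Fintype.card (X j) * G.edgeVariation j (f j)

/-- Private unnormalised strategies whose masses hardly depend on the question lose a constant
fraction of their mass. -/
theorem mul_sub_defect_le_sum_loss [∀ j, Fintype (A j)] (G : MultiplayerGame k X A)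
    (hconn : G.PlayerwiseConnected) (hval : G.value < 1)
    {B : Fin k → Type*} [∀ j, Fintype (B j)] (F : ∀ j, B j → A j)
    (τ : ∀ j, X j → B j → ℝ) (h0 : ∀ j a b, 0 ≤ τ j a b) (h1 : ∀ j a, ∑ b, τ j a b ≤ 1) :
    (1 - G.value) / 2 ^ k * ((∑ q, G.Q q * ∏ j, ∑ b, τ j (q j) b) -
        G.defect fun j a => ∑ b, τ j a b) ≤
      ∑ q, G.Q q * ∑ β : (∀ j, B j), (∏ j, τ j (q j) (β j)) * G.loss q (fun j => F j (β j)) := by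
  set Φ : ∀ j, X j → ℝ := fun j a => ∑ b, τ j a b with hΦ
  have hΦ0 : ∀ j a, 0 ≤ Φ j a := fun j a => Finset.sum_nonneg fun b _ => h0 j a b
  have hmax : ∀ j, ∃ m, ∀ a, Φ j a ≤ Φ j m := fun j => by
    have := (hconn j).nonempty
    exact Finite.exists_max (Φ j)
  choose m hm using hmax
  have hvar0 : ∀ j, 0 ≤ (Fintype.card (X j) : ℝ) * G.edgeVariation j (Φ j) := fun j =>
    mul_nonneg (Nat.cast_nonneg _) (G.edgeVariation_nonneg j _)
  have hPE : (∑ q, G.Q q * ∏ j, Φ j (q j)) ≤ ∏ j, Φ j (m j) := by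
    calc _ ≤ ∑ q, G.Q q * ∏ j, Φ j (m j) := Finset.sum_le_sum fun q _ =>
          mul_le_mul_of_nonneg_left
            (Finset.prod_le_prod (fun j _ => hΦ0 _ _) fun j _ => hm j _) (G.Q_nonneg q)
      _ = _ := by rw [← Finset.sum_mul, G.Q_sum, one_mul]
  have hdef : G.defect Φ = 2 * ∑ j, Fintype.card (X j) * G.edgeVariation j (Φ j) := rfl
  have hdef0 : 0 ≤ G.defect Φ := by
    rw [hdef]; exact mul_nonneg zero_le_two (Finset.sum_nonneg fun j _ => hvar0 j)
  have hε : 0 ≤ (1 - G.value) / 2 ^ k := div_nonneg (by linarith) (by positivity)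
  -- If every variation bound is at most half the maximal mass, all masses are at least half the
  -- maximum, whence the factor `2 ^ k`. Otherwise one player's term already makes the defect exceed
  -- the product of maxima, and the left side is nonpositive.
  by_cases hgood : ∀ j, 2 * (Fintype.card (X j) * G.edgeVariation j (Φ j)) ≤ Φ j (m j)
  · have hL := G.mul_prod_le_sum_kernel F τ h0 (fun j => Φ j (m j) / 2)
      (fun j => div_nonneg (hΦ0 _ _) zero_le_two) (fun j a => by
        have := (hconn j).abs_sub_le (Φ j) (fun a b h => G.abs_sub_le_edgeVariation j (Φ j) h)
          (G.edgeVariation_nonneg j _) (m j) a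
        have h2 := (le_abs_self _).trans this
        have h3 := hgood j
        change _ ≤ Φ j a
        linarith)
    refine le_trans ?_ hL
    rw [Finset.prod_div_distrib, Finset.prod_const, Finset.card_univ, Fintype.card_fin,
      ← mul_div_assoc, div_mul_eq_mul_div]
    refine div_le_div_of_nonneg_right (mul_le_mul_of_nonneg_left ?_ (by linarith)) (by positivity)
    linarith
  · push Not at hgood
    obtain ⟨j, hj⟩ := hgood
    refine le_trans (mul_nonpos_of_nonneg_of_nonpos hε ?_) (Finset.sum_nonneg fun q _ =>
      mul_nonneg (G.Q_nonneg _) <| Finset.sum_nonneg fun β _ =>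
        mul_nonneg (Finset.prod_nonneg fun _ _ => h0 _ _ _) (G.loss_nonneg _ _))
    have h2 : ∏ j, Φ j (m j) ≤ Φ j (m j) := by
      rw [prod_univ_eq_mul_prod_erase j (fun j => Φ j (m j))]
      exact mul_le_of_le_one_right (hΦ0 _ _)
        (Finset.prod_le_one (fun _ _ => hΦ0 _ _) fun _ _ => h1 _ _)
    have h3 := Finset.single_le_sum
      (f := fun j => (Fintype.card (X j) : ℝ) * G.edgeVariation j (Φ j))
      (fun j _ => hvar0 j) (mem_univ j)
    linarith

/-! ### Mixtures of product distributions and slices -/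

/-- A representation of the query distribution as a mixture of product distributions: `weight` is
the mixing measure and `kernel j y` the question distribution of player `j` in the component `y`. -/
structure QueryDecomposition (G : MultiplayerGame k X A) (Y : Type*) [Fintype Y] where
  /-- the mixing measure -/
  weight : Y → ℝ
  /-- the conditional question distributions -/
  kernel : ∀ j, Y → X j → ℝ
  weight_nonneg : ∀ y, 0 ≤ weight y
  kernel_nonneg : ∀ j y a, 0 ≤ kernel j y a
  kernel_sum : ∀ j y, ∑ a, kernel j y a = 1
  mix : ∀ x, ∑ y, weight y * ∏ j, kernel j y (x j) = G.Q x

namespace QueryDecomposition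

variable {G : MultiplayerGame k X A} {Y : Type*} [Fintype Y]

theorem weight_sum (D : G.QueryDecomposition Y) : ∑ y, D.weight y = 1 := by
  have h := G.Q_sum
  simp_rw [← D.mix] at h
  rw [Finset.sum_comm] at h
  rw [← h]
  refine Finset.sum_congr rfl fun y _ => ?_
  rw [← Finset.mul_sum, sum_pi_prod (fun j a => D.kernel j y a)]
  simp [D.kernel_sum]

theorem sum_prod_weight (D : G.QueryDecomposition Y) (n : ℕ) :
    ∑ r : Fin n → Y, ∏ l, D.weight (r l) = 1 := by
  rw [sum_pi_prod (fun _ y => D.weight y)]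
  simp [D.weight_sum]

/-- The probability of the questions `x` of player `j` outside coordinate `i`, given the mixture
components. -/
noncomputable def restKernel (D : G.QueryDecomposition Y) {n : ℕ} (i : Fin n) (r : Fin n → Y)
    (j : Fin k) (x : Fin n → X j) : ℝ :=
  ∏ l ∈ univ.erase i, D.kernel j (r l) (x l)

theorem restKernel_nonneg (D : G.QueryDecomposition Y) {n : ℕ} (i : Fin n) (r : Fin n → Y)
    (j : Fin k) (x : Fin n → X j) : 0 ≤ D.restKernel i r j x :=
  Finset.prod_nonneg fun _ _ => D.kernel_nonneg _ _ _

/-- An expectation over the questions of the repeated game, computed by first choosing mixture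
components for all coordinates and resampling the questions outside coordinate `i`. -/
theorem sum_prod_Q_mul (D : G.QueryDecomposition Y) {n : ℕ} (i : Fin n)
    (h : (∀ j, Fin n → X j) → ℝ) :
    ∑ x : (∀ j, Fin n → X j), (∏ l, G.Q (fun j => x j l)) * h x =
      ∑ r : Fin n → Y, (∏ l, D.weight (r l)) *
        ∑ x : (∀ j, Fin n → X j), G.Q (fun j => x j i) *
          ((∏ j, D.restKernel i r j (x j)) * h x) := by
  simp_rw [Finset.mul_sum]
  rw [Finset.sum_comm]
  refine Finset.sum_congr rfl fun x _ => ?_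
  have e1 : ∀ r : Fin n → Y, (∏ l, D.weight (r l)) * (G.Q (fun j => x j i) *
      ((∏ j, D.restKernel i r j (x j)) * h x)) =
      (∏ l, (D.weight (r l) * if l = i then 1 else ∏ j, D.kernel j (r l) (x j l))) *
        (G.Q (fun j => x j i) * h x) := by
    intro r
    rw [Finset.prod_mul_distrib, prod_univ_eq_mul_prod_erase i
      (fun l => if l = i then 1 else ∏ j, D.kernel j (r l) (x j l))]
    have : ∏ l ∈ univ.erase i, (if l = i then 1 else ∏ j, D.kernel j (r l) (x j l)) =
        ∏ j, D.restKernel i r j (x j) := by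
      unfold restKernel
      rw [Finset.prod_comm]
      exact Finset.prod_congr rfl fun l hl => if_neg (Finset.ne_of_mem_erase hl)
    rw [this]
    simp only [if_true]
    ring
  rw [Finset.sum_congr rfl fun r _ => e1 r, ← Finset.sum_mul,
    sum_pi_prod (fun l y => D.weight y * if l = i then 1 else ∏ j, D.kernel j y (x j l)),
    prod_univ_eq_mul_prod_erase i (fun l => G.Q (fun j => x j l)),
    prod_univ_eq_mul_prod_erase i (fun l => ∑ y, D.weight y *
      if l = i then 1 else ∏ j, D.kernel j y (x j l))]
  have e2 : ∏ l ∈ univ.erase i, (∑ y, D.weight y *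
      if l = i then 1 else ∏ j, D.kernel j y (x j l)) =
      ∏ l ∈ univ.erase i, G.Q (fun j => x j l) :=
    Finset.prod_congr rfl fun l hl => by
      rw [← D.mix]
      simp [Finset.ne_of_mem_erase hl]
  rw [e2]
  simp [D.weight_sum]
  ring

open Classical in
/-- The part of the mass of `E` on which the `i`-th question is `a`, given the mixture components
of the other coordinates. -/
noncomputable def slice (D : G.QueryDecomposition Y) {n : ℕ} (i : Fin n) (r : Fin n → Y)
    (j : Fin k) (E : (Fin n → X j) → ℝ) (a : X j) (x : Fin n → X j) : ℝ :=
  if x i = a then D.restKernel i r j x * E x else 0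

theorem slice_nonneg (D : G.QueryDecomposition Y) {n : ℕ} (i : Fin n) (r : Fin n → Y)
    (j : Fin k) (E : (Fin n → X j) → ℝ) (hE : ∀ x, 0 ≤ E x) (a : X j) (x : Fin n → X j) :
    0 ≤ D.slice i r j E a x := by
  unfold slice
  split_ifs
  · exact mul_nonneg (D.restKernel_nonneg _ _ _ _) (hE x)
  · exact le_rfl

theorem sum_slice_one (D : G.QueryDecomposition Y) {n : ℕ} (i : Fin n) (r : Fin n → Y)
    (j : Fin k) (a : X j) : ∑ x, D.slice i r j (fun _ => 1) a x = 1 := by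
  classical
  have e1 : ∀ x : Fin n → X j, D.slice i r j (fun _ => 1) a x =
      ∏ l, if l = i then (if x l = a then 1 else 0) else D.kernel j (r l) (x l) := by
    intro x
    rw [prod_univ_eq_mul_prod_erase i]
    have : ∏ l ∈ univ.erase i, (if l = i then (if x l = a then 1 else 0) else
        D.kernel j (r l) (x l)) = D.restKernel i r j x :=
      Finset.prod_congr rfl fun l hl => if_neg (Finset.ne_of_mem_erase hl)
    rw [this]
    simp [slice]
  rw [Finset.sum_congr rfl fun x _ => e1 x, sum_pi_prod (fun l (b : X j) =>
    if l = i then (if b = a then (1 : ℝ) else 0) else D.kernel j (r l) b)]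
  refine Finset.prod_eq_one fun l _ => ?_
  by_cases hl : l = i
  · simp [hl]
  · simp [hl, D.kernel_sum]

theorem sum_slice_le_one (D : G.QueryDecomposition Y) {n : ℕ} (i : Fin n) (r : Fin n → Y)
    (j : Fin k) (E : (Fin n → X j) → ℝ) (hE : ∀ x, E x ≤ 1) (a : X j) :
    ∑ x, D.slice i r j E a x ≤ 1 := by
  rw [← D.sum_slice_one i r j a]
  refine Finset.sum_le_sum fun x _ => ?_
  unfold slice
  split_ifs
  · exact mul_le_mul_of_nonneg_left (hE x) (D.restKernel_nonneg _ _ _ _)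
  · exact le_rfl

/-- This embeds `G` in coordinate `i`: the slices vanish unless `q` is the vector of `i`-th
questions, so drawing `q` first and the remaining questions privately gives the same sum. -/
theorem sum_sum_prod_slice (D : G.QueryDecomposition Y) {n : ℕ} (i : Fin n) (r : Fin n → Y)
    (E : ∀ j, (Fin n → X j) → ℝ) (h : (∀ j, X j) → (∀ j, Fin n → X j) → ℝ) :
    ∑ q : (∀ j, X j), G.Q q * ∑ x : (∀ j, Fin n → X j),
        (∏ j, D.slice i r j (E j) (q j) (x j)) * h q x =
      ∑ x : (∀ j, Fin n → X j), G.Q (fun j => x j i) *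
        ((∏ j, D.restKernel i r j (x j)) * ((∏ j, E j (x j)) * h (fun j => x j i) x)) := by
  classical
  simp_rw [Finset.mul_sum]
  rw [Finset.sum_comm]
  refine Finset.sum_congr rfl fun x _ => ?_
  rw [Finset.sum_eq_single (fun j => x j i)]
  · simp only [slice, if_true]
    rw [Finset.prod_mul_distrib]
    ring
  · intro q _ hq
    obtain ⟨j, hj⟩ := Function.ne_iff.1 hq
    rw [Finset.prod_eq_zero (mem_univ j) (by simp [slice, Ne.symm hj])]
    ring
  · simp

/-- The losing probability in coordinate `i` on a product event, up to the mean defect. -/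
theorem mul_sub_le_sum_loss [∀ j, Fintype (A j)] (D : G.QueryDecomposition Y)
    (hconn : G.PlayerwiseConnected) (hval : G.value < 1) {n : ℕ}
    (E : ∀ j, (Fin n → X j) → ℝ) (hE0 : ∀ j x, 0 ≤ E j x) (hE1 : ∀ j x, E j x ≤ 1)
    (F : ∀ j, (Fin n → X j) → Fin n → A j) (i : Fin n) :
    (1 - G.value) / 2 ^ k *
        ((∑ x : (∀ j, Fin n → X j), (∏ l, G.Q (fun j => x j l)) * ∏ j, E j (x j)) -
        ∑ r : Fin n → Y, (∏ l, D.weight (r l)) *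
          G.defect fun j a => ∑ x, D.slice i r j (E j) a x) ≤
      ∑ x : (∀ j, Fin n → X j), (∏ l, G.Q (fun j => x j l)) *
        ((∏ j, E j (x j)) * G.loss (fun j => x j i) (fun j => F j (x j) i)) := by
  rw [D.sum_prod_Q_mul i, D.sum_prod_Q_mul i, ← Finset.sum_sub_distrib, Finset.mul_sum]
  refine Finset.sum_le_sum fun r _ => ?_
  -- For fixed `r`, player `j` on question `a` samples `x` with `x i = a`, weighted by `E j`, and
  -- answers `F j x i`.
  have key := G.mul_sub_defect_le_sum_loss hconn hval (fun j (x : Fin n → X j) => F j x i)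
    (fun j a x => D.slice i r j (E j) a x) (fun j a x => D.slice_nonneg i r j _ (hE0 j) a x)
    (fun j a => D.sum_slice_le_one i r j _ (hE1 j) a)
  rw [D.sum_sum_prod_slice i r E (fun q x => G.loss q (fun j => F j (x j) i))] at key
  have e : ∑ q, G.Q q * ∏ j, ∑ x, D.slice i r j (E j) (q j) x =
      ∑ x : (∀ j, Fin n → X j), G.Q (fun j => x j i) *
        ((∏ j, D.restKernel i r j (x j)) * ∏ j, E j (x j)) := by
    have := D.sum_sum_prod_slice i r E (fun _ _ => 1)
    simp only [mul_one] at this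
    rw [← this]
    exact Finset.sum_congr rfl fun q _ => by
      rw [sum_pi_prod (fun j x => D.slice i r j (E j) (q j) x)]
  rw [e] at key
  rw [← mul_sub, mul_left_comm]
  exact mul_le_mul_of_nonneg_left key (Finset.prod_nonneg fun _ _ => D.weight_nonneg _)

open Classical in
/-- A weight that separates the questions `a` and `b` of player `j`: it is centred in every mixture
component, and it integrates to the difference of the two point masses. -/
structure IsSeparating (D : G.QueryDecomposition Y) (j : Fin k) (a b : X j)
    (w : Y → X j → ℝ) (C : ℝ) : Prop where
  centred : ∀ y, ∑ c, D.kernel j y c * w y c = 0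
  integral : ∀ c, ∑ y, D.weight y * (D.kernel j y c * w y c) =
    (if c = a then 1 else 0) - (if c = b then 1 else 0)
  bound : ∀ y c, |w y c| ≤ C

end QueryDecomposition
end MultiplayerGame

/-! ### The mean defect is of order `√n` -/

namespace MultiplayerGame

variable {k : ℕ} {X : Fin k → Type u} {A : Fin k → Type v} [∀ j, Fintype (X j)]

namespace QueryDecomposition

variable {G : MultiplayerGame k X A} {Y : Type*} [Fintype Y]

theorem restKernel_update (D : G.QueryDecomposition Y) {n : ℕ} (i : Fin n) (r : Fin n → Y) (y : Y)
    (j : Fin k) (x : Fin n → X j) :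
    D.restKernel i (Function.update r i y) j x = D.restKernel i r j x :=
  Finset.prod_congr rfl fun l hl => by rw [Function.update_of_ne (Finset.ne_of_mem_erase hl)]

theorem slice_update (D : G.QueryDecomposition Y) {n : ℕ} (i : Fin n) (r : Fin n → Y) (y : Y)
    (j : Fin k) (E : (Fin n → X j) → ℝ) (a : X j) (x : Fin n → X j) :
    D.slice i (Function.update r i y) j E a x = D.slice i r j E a x := by
  unfold slice
  rw [D.restKernel_update]

/-- Bessel-type bound: for fixed mixture components the correlation of `E` with a signed sum of
centred weights is of order `√n`. -/
theorem sum_kernel_mul_le (D : G.QueryDecomposition Y) {n : ℕ} (hn : 1 ≤ n) {j : Fin k} {a b : X j}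
    {w : Y → X j → ℝ} {C : ℝ} (hC : 0 < C) (hw : D.IsSeparating j a b w C)
    (E : (Fin n → X j) → ℝ) (hE0 : ∀ x, 0 ≤ E x) (hE1 : ∀ x, E x ≤ 1) (r : Fin n → Y)
    (s : Fin n → ℝ) (hs : ∀ i, s i ^ 2 = 1) :
    ∑ x : Fin n → X j, (∏ l, D.kernel j (r l) (x l)) *
      (E x * ∑ i, s i * w (r i) (x i)) ≤ C * √n := by
  have hn' : (0 : ℝ) < √n := Real.sqrt_pos.2 (by exact_mod_cast hn)
  -- AM-GM in the form `|S| ≤ S ^ 2 / (2 * t) + t / 2`, with `t ^ 2` equal to the second moment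
  -- bound so that both terms become `t / 2`.
  set t := C * √n with ht
  have htp : 0 < t := mul_pos hC hn'
  have h2 := sum_pi_sq_le (fun (l : Fin n) c => D.kernel j (r l) c)
    (fun l c => D.kernel_nonneg _ _ _) (fun l => D.kernel_sum j (r l))
    (fun i c => s i * w (r i) c)
    (fun i => by
      rw [← mul_zero (s i), ← hw.centred (r i), Finset.mul_sum]
      exact Finset.sum_congr rfl fun c _ => by ring)
    (C ^ 2) (fun i c => by
      rw [mul_pow, hs, one_mul]
      exact sq_le_sq' (abs_le.1 (hw.bound (r i) c)).1 (abs_le.1 (hw.bound (r i) c)).2)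
  have hP1 : ∑ x : Fin n → X j, ∏ l, D.kernel j (r l) (x l) = 1 := by
    rw [sum_pi_prod (fun (l : Fin n) c => D.kernel j (r l) c)]
    simp [D.kernel_sum]
  calc _ ≤ ∑ x : Fin n → X j, (∏ l, D.kernel j (r l) (x l)) *
        ((∑ i, s i * w (r i) (x i)) ^ 2 * (1 / (2 * t)) + t / 2) := by
        refine Finset.sum_le_sum fun x _ => mul_le_mul_of_nonneg_left ?_
          (Finset.prod_nonneg fun _ _ => D.kernel_nonneg _ _ _)
        set S := ∑ i, s i * w (r i) (x i)
        have h3 : E x * S ≤ |S| := by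
          refine (le_abs_self _).trans ?_
          rw [abs_mul, abs_of_nonneg (hE0 x)]
          exact mul_le_of_le_one_left (abs_nonneg _) (hE1 x)
        refine h3.trans ?_
        have h4 : 0 ≤ (|S| - t) ^ 2 / (2 * t) := by positivity
        have h5 : S ^ 2 * (1 / (2 * t)) + t / 2 - |S| = (|S| - t) ^ 2 / (2 * t) := by
          rw [← sq_abs S]
          field_simp
          ring
        linarith
    _ = (∑ x : Fin n → X j, (∏ l, D.kernel j (r l) (x l)) *
          (∑ i, s i * w (r i) (x i)) ^ 2) * (1 / (2 * t)) + t / 2 := by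
        simp_rw [mul_add]
        rw [Finset.sum_add_distrib, ← Finset.sum_mul, hP1, one_mul, Finset.sum_mul]
        simp_rw [mul_assoc]
    _ ≤ (t ^ 2) * (1 / (2 * t)) + t / 2 := by
        refine add_le_add_left (mul_le_mul_of_nonneg_right ?_ (by positivity)) _
        refine h2.trans (le_of_eq ?_)
        rw [Fintype.card_fin, ht, mul_pow, Real.sq_sqrt (Nat.cast_nonneg n), mul_comm]
    _ = t := by field_simp; ring

/-- The sign of the difference does not depend on `r i`. So `integral`, with independence of `r i`
from the other components, replaces the comparison of `x i = a` with `x i = b` by the weight `w (r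
i) (x i)`, where `x i` is now drawn from its component. For each fixed `r` all coordinates then
share one measure and one `E`, and the Bessel-type bound applies. -/
theorem sum_abs_sub_le (D : G.QueryDecomposition Y) {n : ℕ} (hn : 1 ≤ n) {j : Fin k} {a b : X j}
    {w : Y → X j → ℝ} {C : ℝ} (hC : 0 < C) (hw : D.IsSeparating j a b w C)
    (E : (Fin n → X j) → ℝ) (hE0 : ∀ x, 0 ≤ E x) (hE1 : ∀ x, E x ≤ 1) :
    ∑ i, ∑ r : Fin n → Y, (∏ l, D.weight (r l)) *
      |∑ x, D.slice i r j E a x - ∑ x, D.slice i r j E b x| ≤ C * √n := by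
  classical
  set s : Fin n → (Fin n → Y) → ℝ := fun i r =>
    if 0 ≤ ∑ x, D.slice i r j E a x - ∑ x, D.slice i r j E b x then 1 else -1 with hs
  have hs2 : ∀ i r, s i r ^ 2 = 1 := by
    intro i r
    simp only [hs]
    split_ifs <;> norm_num
  have hsabs : ∀ i r, |∑ x, D.slice i r j E a x - ∑ x, D.slice i r j E b x| =
      s i r * (∑ x, D.slice i r j E a x - ∑ x, D.slice i r j E b x) := by
    intro i r
    simp only [hs]
    split_ifs with h
    · rw [abs_of_nonneg h, one_mul]
    · rw [abs_of_neg (not_le.1 h), neg_one_mul]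
  have hsu : ∀ i r y, s i (Function.update r i y) = s i r := by
    intro i r y
    simp only [hs, D.slice_update]
  have e1 : ∀ i, ∑ r : Fin n → Y, (∏ l, D.weight (r l)) *
      |∑ x, D.slice i r j E a x - ∑ x, D.slice i r j E b x| =
      ∑ r : Fin n → Y, (∏ l, D.weight (r l)) * ∑ x : Fin n → X j,
        (∏ l, D.kernel j (r l) (x l)) * (E x * (s i r * w (r i) (x i))) := by
    intro i
    have l1 : ∀ r : Fin n → Y, (∏ l, D.weight (r l)) *
        |∑ x, D.slice i r j E a x - ∑ x, D.slice i r j E b x| =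
        ∑ x : Fin n → X j, (((if x i = a then 1 else 0) - (if x i = b then 1 else 0)) * E x) *
          ((∏ l, D.weight (r l)) * (s i r * D.restKernel i r j x)) := by
      intro r
      rw [hsabs, ← Finset.sum_sub_distrib, Finset.mul_sum, Finset.mul_sum]
      refine Finset.sum_congr rfl fun x _ => ?_
      unfold slice
      split_ifs <;> ring
    rw [Finset.sum_congr rfl fun r _ => l1 r, Finset.sum_comm]
    simp_rw [Finset.mul_sum]
    rw [Finset.sum_comm (s := (univ : Finset (Fin n → Y)))]
    refine Finset.sum_congr rfl fun x _ => ?_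
    rw [← Finset.mul_sum, ← hw.integral (x i), mul_right_comm,
      ← sum_pi_indep D.weight D.weight_sum i (fun y => D.kernel j y (x i) * w y (x i))
        (fun r => s i r * D.restKernel i r j x)
        (fun r y => by rw [hsu, D.restKernel_update]), Finset.sum_mul]
    refine Finset.sum_congr rfl fun r _ => ?_
    rw [prod_univ_eq_mul_prod_erase i (fun l => D.kernel j (r l) (x l))]
    unfold restKernel
    ring
  rw [Finset.sum_congr rfl fun i _ => e1 i, Finset.sum_comm]
  calc _ = ∑ r : Fin n → Y, (∏ l, D.weight (r l)) * ∑ x : Fin n → X j,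
        (∏ l, D.kernel j (r l) (x l)) * (E x * ∑ i, s i r * w (r i) (x i)) := by
        refine Finset.sum_congr rfl fun r _ => ?_
        rw [← Finset.mul_sum, Finset.sum_comm]
        simp_rw [Finset.mul_sum]
    _ ≤ ∑ r : Fin n → Y, (∏ l, D.weight (r l)) * (C * √n) :=
        Finset.sum_le_sum fun r _ => mul_le_mul_of_nonneg_left
          (D.sum_kernel_mul_le hn hC hw E hE0 hE1 r (fun i => s i r) (fun i => hs2 i r))
          (Finset.prod_nonneg fun _ _ => D.weight_nonneg _)
    _ = C * √n := by rw [← Finset.sum_mul, D.sum_prod_weight, one_mul]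

/-- The mean defect, summed over all coordinates, is of order `√n`. -/
theorem sum_defect_le (D : G.QueryDecomposition Y) {C : ℝ} (hC : 0 < C)
    (hD : ∀ j a b, (G.playerGraph j).Adj a b → ∃ w, D.IsSeparating j a b w C)
    {n : ℕ} (hn : 1 ≤ n) (E : ∀ j, (Fin n → X j) → ℝ) (hE0 : ∀ j x, 0 ≤ E j x)
    (hE1 : ∀ j x, E j x ≤ 1) :
    ∑ i, ∑ r : Fin n → Y, (∏ l, D.weight (r l)) *
        (G.defect fun j a => ∑ x, D.slice i r j (E j) a x) ≤
      (2 * ∑ j, (Fintype.card (X j) : ℝ) ^ 3 * C) * √n := by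
  classical
  have e1 : ∀ (i : Fin n) (r : Fin n → Y), (∏ l, D.weight (r l)) *
        (G.defect fun j a => ∑ x, D.slice i r j (E j) a x) =
      2 * ∑ j, (Fintype.card (X j) : ℝ) * ∑ a, ∑ b, if (G.playerGraph j).Adj a b then
        (∏ l, D.weight (r l)) *
          |∑ x, D.slice i r j (E j) a x - ∑ x, D.slice i r j (E j) b x| else 0 := by
    intro i r
    unfold defect edgeVariation
    rw [mul_left_comm, Finset.mul_sum]
    congr 1
    refine Finset.sum_congr rfl fun j _ => ?_
    rw [mul_left_comm, Finset.mul_sum]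
    congr 1
    refine Finset.sum_congr rfl fun a _ => ?_
    rw [Finset.mul_sum]
    refine Finset.sum_congr rfl fun b _ => ?_
    split_ifs <;> simp
  have e2 : ∑ i, ∑ r : Fin n → Y, (∏ l, D.weight (r l)) *
        (G.defect fun j a => ∑ x, D.slice i r j (E j) a x) =
      2 * ∑ j, (Fintype.card (X j) : ℝ) * ∑ a, ∑ b, if (G.playerGraph j).Adj a b then
        ∑ i, ∑ r : Fin n → Y, (∏ l, D.weight (r l)) *
          |∑ x, D.slice i r j (E j) a x - ∑ x, D.slice i r j (E j) b x| else 0 := by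
    simp_rw [e1, ← Finset.sum_product' univ univ, ← Finset.mul_sum]
    congr 1
    rw [Finset.sum_comm]
    refine Finset.sum_congr rfl fun j _ => ?_
    rw [← Finset.mul_sum, Finset.sum_comm]
    congr 1
    refine Finset.sum_congr rfl fun q _ => ?_
    split_ifs <;> simp
  rw [e2, mul_assoc, Finset.sum_mul]
  refine mul_le_mul_of_nonneg_left (Finset.sum_le_sum fun j _ => ?_) zero_le_two
  -- One factor of the cardinality comes from path lengths, two from the pairs `(a, b)`.
  calc _ ≤ (Fintype.card (X j) : ℝ) * ∑ _a : X j, ∑ _b : X j, C * √n := by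
        refine mul_le_mul_of_nonneg_left (Finset.sum_le_sum fun a _ => Finset.sum_le_sum
          fun b _ => ?_) (Nat.cast_nonneg _)
        split_ifs with h
        · obtain ⟨w, hw⟩ := hD j a b h
          exact D.sum_abs_sub_le hn hC hw (E j) (hE0 j) (hE1 j)
        · positivity
    _ = _ := by simp; ring

end QueryDecomposition

/-! ### The edge decomposition of the query distribution -/

theorem exists_pos_le_Q (G : MultiplayerGame k X A) : ∃ m > 0, ∀ x ∈ G.support, m ≤ G.Q x := by
  classical
  rcases G.support.eq_empty_or_nonempty with h | h
  · exact ⟨1, one_pos, by simp [h]⟩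
  · obtain ⟨x, hx, hm⟩ := Set.exists_min_image G.support G.Q (Set.toFinite _) h
    exact ⟨G.Q x, hx, hm⟩

/-- A pair of questions of some player, with questions to the other players. -/
abbrev Edge (X : Fin k → Type u) : Type u := Σ j, X j × X j × (∀ i, X i)

open Classical in
/-- The uniform distribution on the two question vectors of an edge, restricted to player `j`. -/
noncomputable def edgeKernel (j : Fin k) (e : Edge X) (c : X j) : ℝ :=
  (if c = Function.update e.2.2.2 e.1 e.2.1 j then 1 / 2 else 0) +
    (if c = Function.update e.2.2.2 e.1 e.2.2.1 j then 1 / 2 else 0)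

set_option linter.unusedSectionVars false in
theorem edgeKernel_nonneg (j : Fin k) (e : Edge X) (c : X j) : 0 ≤ edgeKernel j e c := by
  unfold edgeKernel
  split_ifs <;> norm_num

theorem edgeKernel_sum (j : Fin k) (e : Edge X) : ∑ c, edgeKernel j e c = 1 := by
  classical
  have h : ∀ t : X j, ∑ c, (if c = t then (1 / 2 : ℝ) else 0) = 1 / 2 := fun t => by simp
  unfold edgeKernel
  rw [Finset.sum_add_distrib]
  calc _ = (1 / 2 : ℝ) + 1 / 2 := by congr 1 <;> convert h _
    _ = 1 := by norm_num

/-- Both question vectors of the edge are asked with positive probability. -/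
def IsAsked (G : MultiplayerGame k X A) (e : Edge X) : Prop :=
  Function.update e.2.2.2 e.1 e.2.1 ∈ G.support ∧ Function.update e.2.2.2 e.1 e.2.2.1 ∈ G.support

/-- Only one player's question varies along an edge, so the product of the marginals charges nothing
but the two endpoints. This is why a small multiple of it can be split off from `Q`. -/
theorem mem_support_of_edgeKernel (G : MultiplayerGame k X A) {e : Edge X} (he : G.IsAsked e)
    {x : ∀ j, X j} (h : ∏ j, edgeKernel j e (x j) ≠ 0) : x ∈ G.support := by
  obtain ⟨j, a, b, z⟩ := e
  have h1 : ∀ i, edgeKernel i ⟨j, a, b, z⟩ (x i) ≠ 0 := fun i hi =>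
    h (Finset.prod_eq_zero (mem_univ i) hi)
  have h2 : ∀ i, i ≠ j → x i = z i := by
    intro i hi
    by_contra hne
    exact h1 i (by simp [edgeKernel, hi, hne])
  have h3 : x = Function.update z j (x j) := by
    ext i
    by_cases hi : i = j
    · subst hi; simp
    · rw [Function.update_of_ne hi, h2 i hi]
  have h4 : x j = a ∨ x j = b := by
    by_contra! hne
    exact h1 j (by simp [edgeKernel, hne.1, hne.2])
  rcases h4 with h4 | h4
  · rw [h3, h4]; exact he.1
  · rw [h3, h4]; exact he.2

open Classical in
/-- The query distribution as a mixture of point masses and uniform distributions on edges. -/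
noncomputable def edgeDecomposition (G : MultiplayerGame k X A) (η : ℝ) (hη : 0 ≤ η)
    (h : ∀ x ∈ G.support, Fintype.card (Edge X) * η ≤ G.Q x) :
    G.QueryDecomposition ((∀ j, X j) ⊕ Edge X) where
  -- The point masses carry what the edges leave over. Each edge removes at most `η` from a vector
  -- in the support and nothing elsewhere.
  weight y := y.elim
    (fun x => G.Q x - ∑ e : Edge X, (if G.IsAsked e then η else 0) * ∏ j, edgeKernel j e (x j))
    (fun e => if G.IsAsked e then η else 0)
  kernel j y c := y.elim (fun x => if x j = c then 1 else 0) (fun e => edgeKernel j e c)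
  weight_nonneg := by
    rintro (x | e)
    · simp only [Sum.elim_inl, sub_nonneg]
      by_cases hx : x ∈ G.support
      · refine le_trans ?_ (h x hx)
        calc _ ≤ ∑ _e : Edge X, η := by
              refine Finset.sum_le_sum fun e _ => ?_
              have h1 : ∏ j, edgeKernel j e (x j) ≤ 1 :=
                Finset.prod_le_one (fun _ _ => edgeKernel_nonneg _ _ _) fun j _ => by
                  rw [← edgeKernel_sum j e]
                  exact Finset.single_le_sum (f := fun c => edgeKernel j e c)
                    (fun c _ => edgeKernel_nonneg _ _ _) (mem_univ _)
              split_ifs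
              · exact mul_le_of_le_one_right hη h1
              · rw [zero_mul]; exact hη
          _ = _ := by simp
      · rw [Finset.sum_eq_zero]
        · exact G.Q_nonneg x
        · intro e _
          split_ifs with he
          · by_contra hne
            exact hx (G.mem_support_of_edgeKernel he (right_ne_zero_of_mul hne))
          · rw [zero_mul]
    · simp only [Sum.elim_inr]
      split_ifs
      · exact hη
      · exact le_rfl
  kernel_nonneg := by
    rintro j (x | e) c
    · simp only [Sum.elim_inl]
      split_ifs <;> norm_num
    · exact edgeKernel_nonneg _ _ _
  kernel_sum := by
    rintro j (x | e)
    · simp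
    · exact edgeKernel_sum j e
  mix x := by
    rw [Fintype.sum_sum_type]
    simp only [Sum.elim_inl, Sum.elim_inr]
    rw [Finset.sum_eq_single x]
    · simp
    · intro y _ hy
      obtain ⟨j, hj⟩ := Function.ne_iff.1 hy
      rw [Finset.prod_eq_zero (mem_univ j) (if_neg hj), mul_zero]
    · simp

/-- The weight lives on the component of the edge itself, with values `2 / η` at `a` and `-2 / η` at
`b`. Both have kernel mass `1 / 2`, so it is centred, and `η * (1 / 2) * (2 / η) = 1` gives the
integral. -/
theorem edgeDecomposition_isSeparating (G : MultiplayerGame k X A) (η : ℝ) (hη : 0 < η)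
    (h : ∀ x ∈ G.support, Fintype.card (Edge X) * η ≤ G.Q x) (j : Fin k) (a b : X j)
    (hab : (G.playerGraph j).Adj a b) :
    ∃ w, (G.edgeDecomposition η hη.le h).IsSeparating j a b w (2 / η) := by
  classical
  obtain ⟨hne, z, hz⟩ := hab
  have hasked : G.IsAsked (⟨j, a, b, z⟩ : Edge X) := hz
  have hker : ∀ c, edgeKernel j ⟨j, a, b, z⟩ c =
      (if c = a then 1 / 2 else 0) + (if c = b then 1 / 2 else 0) := by
    intro c
    unfold edgeKernel
    simp
  refine ⟨fun y c => if y = Sum.inr ⟨j, a, b, z⟩ then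
    2 / η * ((if c = a then 1 else 0) - (if c = b then 1 else 0)) else 0, ?_, ?_, ?_⟩
  · intro y
    by_cases hy : y = Sum.inr ⟨j, a, b, z⟩
    · subst hy
      simp only [if_true, edgeDecomposition, Sum.elim_inr, hker]
      have : ∀ c, ((if c = a then (1 / 2 : ℝ) else 0) + (if c = b then 1 / 2 else 0)) *
          (2 / η * ((if c = a then 1 else 0) - (if c = b then 1 else 0))) =
          (if c = a then 1 / η else 0) - (if c = b then 1 / η else 0) := by
        intro c
        by_cases h1 : c = a
        · subst h1; simp [hne]; field_simp
        · by_cases h2 : c = b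
          · subst h2; simp [h1]; field_simp
          · simp [h1, h2]
      rw [Finset.sum_congr rfl fun c _ => this c, Finset.sum_sub_distrib]
      simp
    · simp [hy]
  · intro c
    rw [Finset.sum_eq_single (Sum.inr ⟨j, a, b, z⟩)]
    · simp only [if_true, edgeDecomposition, Sum.elim_inr, hker, if_pos hasked]
      by_cases h1 : c = a
      · subst h1; simp [hne]; field_simp
      · by_cases h2 : c = b
        · subst h2; simp [h1]; field_simp
        · simp [h1, h2]
    · intro y _ hy
      simp [hy]
    · simp
  · intro y c
    have hpos : 0 < 2 / η := by positivity
    rw [abs_le]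
    constructor <;> split_ifs <;> linarith

/-! ### Losing a coordinate of the repeated game -/

/-- On product events, the average probability of losing a coordinate is at least a constant
multiple of the probability of the event, up to an error of order `1 / √n`. -/
theorem exists_sum_loss_ge [∀ j, Fintype (A j)] (G : MultiplayerGame k X A)
    (hconn : G.PlayerwiseConnected) (hval : G.value < 1) :
    ∃ C : ℝ, 0 ≤ C ∧ ∀ n : ℕ, 1 ≤ n → ∀ (F : ∀ j, (Fin n → X j) → Fin n → A j)
      (E : ∀ j, (Fin n → X j) → ℝ), (∀ j x, 0 ≤ E j x) → (∀ j x, E j x ≤ 1) →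
      (1 - G.value) / 2 ^ k *
        (n * (∑ x : (∀ j, Fin n → X j), (∏ l, G.Q (fun j => x j l)) * ∏ j, E j (x j)) -
          C * √n) ≤
      ∑ i, ∑ x : (∀ j, Fin n → X j), (∏ l, G.Q (fun j => x j l)) *
        ((∏ j, E j (x j)) * G.loss (fun j => x j i) (fun j => F j (x j) i)) := by
  classical
  obtain ⟨m, hm, hmQ⟩ := G.exists_pos_le_Q
  set η := m / (Fintype.card (Edge X) + 1) with hη
  have hη0 : 0 < η := by positivity
  have hηQ : ∀ x ∈ G.support, Fintype.card (Edge X) * η ≤ G.Q x := by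
    intro x hx
    refine le_trans ?_ (hmQ x hx)
    rw [hη, ← mul_div_assoc, div_le_iff₀ (by positivity)]
    nlinarith
  set D := G.edgeDecomposition η hη0.le hηQ
  have hsep := G.edgeDecomposition_isSeparating η hη0 hηQ
  refine ⟨2 * ∑ j, (Fintype.card (X j) : ℝ) ^ 3 * (2 / η), by positivity, ?_⟩
  intro n hn F E hE0 hE1
  have h1 := D.sum_defect_le (by positivity) hsep hn E hE0 hE1
  refine le_trans ?_ (Finset.sum_le_sum fun i _ => D.mul_sub_le_sum_loss hconn hval E hE0 hE1 F i)
  rw [← Finset.mul_sum, Finset.sum_sub_distrib]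
  refine mul_le_mul_of_nonneg_left ?_ (div_nonneg (by linarith) (by positivity))
  simp only [Finset.sum_const, Finset.card_univ, Fintype.card_fin, nsmul_eq_mul]
  linarith

/-- Every single coordinate of the repeated game is lost at least as often as the game itself. -/
theorem one_sub_value_le_sum_loss_coord [∀ j, Fintype (A j)] (G : MultiplayerGame k X A)
    {n : ℕ} (F : ∀ j, (Fin n → X j) → Fin n → A j) (i : Fin n) :
    1 - G.value ≤ ∑ x : (∀ j, Fin n → X j), (∏ l, G.Q (fun j => x j l)) *
      G.loss (fun j => x j i) (fun j => F j (x j) i) := by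
  -- Separation is not needed here, so `η = 0` suffices: for the constant event all slices have mass
  -- one and there is no defect.
  set D := G.edgeDecomposition 0 le_rfl (fun x _ => by simpa using G.Q_nonneg x)
  rw [D.sum_prod_Q_mul i]
  calc 1 - G.value = ∑ r : Fin n → (∀ j, X j) ⊕ Edge X, (∏ l, D.weight (r l)) * (1 - G.value) := by
        rw [← Finset.sum_mul, D.sum_prod_weight, one_mul]
    _ ≤ _ := by
        refine Finset.sum_le_sum fun r _ => mul_le_mul_of_nonneg_left ?_
          (Finset.prod_nonneg fun _ _ => D.weight_nonneg _)
        have key := G.one_sub_value_le_sum_kernel (fun j (x : Fin n → X j) => F j x i)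
          (fun j a x => D.slice i r j (fun _ => 1) a x)
          (fun j a x => D.slice_nonneg i r j _ (fun _ => zero_le_one) a x)
          (fun j a => D.sum_slice_one i r j a)
        rw [D.sum_sum_prod_slice i r (fun _ _ => 1)
          (fun q x => G.loss q (fun j => F j (x j) i))] at key
        simpa using key

end MultiplayerGame

/-! ### Conditioning on coordinates already won -/

namespace MultiplayerGame

variable {k : ℕ} {X : Fin k → Type u} {A : Fin k → Type v} [∀ j, Fintype (X j)]

open Classical in
/-- The probability that the strategy `F` wins all coordinates in `S`. -/
noncomputable def winProbOn (G : MultiplayerGame k X A) {n : ℕ}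
    (F : ∀ j, (Fin n → X j) → Fin n → A j) (S : Finset (Fin n)) : ℝ :=
  ∑ x : (∀ j, Fin n → X j), (∏ l, G.Q (fun j => x j l)) *
    if ∀ l ∈ S, G.V (fun j => x j l) (fun j => F j (x j) l) = true then 1 else 0

theorem winProb_parallelRep (G : MultiplayerGame k X A) {n : ℕ}
    (F : ∀ j, (Fin n → X j) → Fin n → A j) : (G.parallelRep n).winProb F = G.winProbOn F univ := by
  classical
  unfold winProb winProbOn parallelRep
  refine Finset.sum_congr rfl fun x _ => ?_
  simp

theorem winProbOn_anti (G : MultiplayerGame k X A) {n : ℕ}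
    (F : ∀ j, (Fin n → X j) → Fin n → A j) {S T : Finset (Fin n)} (h : S ⊆ T) :
    G.winProbOn F T ≤ G.winProbOn F S := by
  classical
  refine Finset.sum_le_sum fun x _ => mul_le_mul_of_nonneg_left ?_
    (Finset.prod_nonneg fun _ _ => G.Q_nonneg _)
  split_ifs with h1 h2
  · exact le_rfl
  · exact absurd (fun l hl => h1 l (h hl)) h2
  · exact zero_le_one
  · exact le_rfl

theorem winProbOn_nonneg (G : MultiplayerGame k X A) {n : ℕ}
    (F : ∀ j, (Fin n → X j) → Fin n → A j) (S : Finset (Fin n)) : 0 ≤ G.winProbOn F S := by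
  classical
  refine Finset.sum_nonneg fun x _ => mul_nonneg (Finset.prod_nonneg fun _ _ => G.Q_nonneg _) ?_
  split_ifs <;> norm_num

theorem winProbOn_empty (G : MultiplayerGame k X A) {n : ℕ}
    (F : ∀ j, (Fin n → X j) → Fin n → A j) : G.winProbOn F ∅ = 1 := by
  unfold winProbOn
  simp [G.sum_prod_Q n]

theorem winProbOn_insert (G : MultiplayerGame k X A) {n : ℕ}
    (F : ∀ j, (Fin n → X j) → Fin n → A j) (S : Finset (Fin n)) (i : Fin n) :
    G.winProbOn F S - G.winProbOn F (insert i S) =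
      ∑ x : (∀ j, Fin n → X j), (∏ l, G.Q (fun j => x j l)) *
        ((open Classical in
          if ∀ l ∈ S, G.V (fun j => x j l) (fun j => F j (x j) l) = true then 1 else 0) *
          G.loss (fun j => x j i) (fun j => F j (x j) i)) := by
  classical
  unfold winProbOn
  rw [← Finset.sum_sub_distrib]
  refine Finset.sum_congr rfl fun x _ => ?_
  rw [← mul_sub]
  congr 1
  unfold loss
  by_cases h1 : ∀ l ∈ S, G.V (fun j => x j l) (fun j => F j (x j) l) = true
  · by_cases h2 : G.V (fun j => x j i) (fun j => F j (x j) i) = true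
    · simp [h2]
    · simp [h2]
  · simp [h1]

/-- The probability of winning in a single coordinate is at most the value. -/
theorem winProbOn_singleton_le [∀ j, Fintype (A j)] (G : MultiplayerGame k X A) {n : ℕ}
    (F : ∀ j, (Fin n → X j) → Fin n → A j) (i : Fin n) : G.winProbOn F {i} ≤ G.value := by
  have h := G.winProbOn_insert F ∅ i
  have h2 := G.one_sub_value_le_sum_loss_coord F i
  rw [G.winProbOn_empty, insert_empty_eq] at h
  simp only [Finset.notMem_empty, false_imp_iff, implies_true, if_true, one_mul] at h
  linarith

open Classical in
/-- The indicator that the questions and answers of player `j` in the coordinates of `S` are the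
given ones. -/
noncomputable def transcriptIndicator {n : ℕ} (F : ∀ j, (Fin n → X j) → Fin n → A j)
    (S : Finset (Fin n)) (c : S → ∀ j, X j × A j) (j : Fin k) (x : Fin n → X j) : ℝ :=
  if ∀ l : S, c l j = (x l, F j x l) then 1 else 0

-- The predicate couples the players, so winning on `S` is not itself a product event. It is
-- determined by the transcript on `S`, and each player alone can check its own part of a given
-- transcript.
open Classical in
theorem sum_transcriptIndicator [∀ j, Fintype (A j)] (G : MultiplayerGame k X A) {n : ℕ}
    (F : ∀ j, (Fin n → X j) → Fin n → A j) (S : Finset (Fin n)) (x : ∀ j, Fin n → X j) :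
    (∑ c : S → ∀ j, X j × A j,
      if ∀ l, G.V (fun j => (c l j).1) (fun j => (c l j).2) = true then
        ∏ j, transcriptIndicator F S c j (x j) else 0) =
      if ∀ l ∈ S, G.V (fun j => x j l) (fun j => F j (x j) l) = true then (1 : ℝ) else 0 := by
  rw [Finset.sum_eq_single (fun (l : S) (j : Fin k) => (x j l, F j (x j) l))]
  · simp [transcriptIndicator]
  · intro c _ hc
    obtain ⟨l, hl⟩ := Function.ne_iff.1 hc
    obtain ⟨j, hj⟩ := Function.ne_iff.1 hl
    have : transcriptIndicator F S c j (x j) = 0 := if_neg fun h => hj (h l)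
    rw [Finset.prod_eq_zero (mem_univ j) this, ite_self]
  · simp

/-- Some coordinate `i` has a constant probability of being lost, given that all coordinates in `S`
are won, up to an error of order `N ^ |S| / √n`. -/
theorem exists_winProbOn_insert_le [∀ j, Fintype (A j)] (G : MultiplayerGame k X A)
    (hconn : G.PlayerwiseConnected) (hval : G.value < 1) :
    ∃ C : ℝ, 0 ≤ C ∧ ∀ n : ℕ, 1 ≤ n → ∀ (F : ∀ j, (Fin n → X j) → Fin n → A j)
      (S : Finset (Fin n)), ∃ i, G.winProbOn F (insert i S) ≤
        (1 - (1 - G.value) / 2 ^ k) * G.winProbOn F S +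
          C * (Fintype.card (∀ j, X j × A j) : ℝ) ^ S.card / √n := by
  classical
  obtain ⟨C, hC, h⟩ := G.exists_sum_loss_ge hconn hval
  set ε := (1 - G.value) / 2 ^ k with hε
  have hε0 : 0 ≤ ε := div_nonneg (by linarith) (by positivity)
  refine ⟨ε * C, mul_nonneg hε0 hC, fun n hn F S => ?_⟩
  set N : ℝ := (Fintype.card (∀ j, X j × A j) : ℝ)
  have hsn : 0 < √(n : ℝ) := Real.sqrt_pos.2 (by exact_mod_cast hn)
  have hnn : (n : ℝ) = √n * √n := (Real.mul_self_sqrt (Nat.cast_nonneg n)).symm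
  have hwin : ∀ g : (∀ j, Fin n → X j) → ℝ, ∑ x : (∀ j, Fin n → X j),
      (∏ l, G.Q (fun j => x j l)) *
        ((if ∀ l ∈ S, G.V (fun j => x j l) (fun j => F j (x j) l) = true then 1 else 0) * g x) =
      ∑ c : S → ∀ j, X j × A j,
        if ∀ l, G.V (fun j => (c l j).1) (fun j => (c l j).2) = true then
          ∑ x : (∀ j, Fin n → X j), (∏ l, G.Q (fun j => x j l)) *
            ((∏ j, transcriptIndicator F S c j (x j)) * g x) else 0 := by
    intro g
    have : ∀ x : (∀ j, Fin n → X j), (∏ l, G.Q (fun j => x j l)) *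
        ((if ∀ l ∈ S, G.V (fun j => x j l) (fun j => F j (x j) l) = true then 1 else 0) * g x) =
        ∑ c : S → ∀ j, X j × A j,
          if ∀ l, G.V (fun j => (c l j).1) (fun j => (c l j).2) = true then
            (∏ l, G.Q (fun j => x j l)) *
              ((∏ j, transcriptIndicator F S c j (x j)) * g x) else 0 := by
      intro x
      rw [← G.sum_transcriptIndicator F S x, Finset.sum_mul, Finset.mul_sum]
      refine Finset.sum_congr rfl fun c _ => ?_
      split_ifs <;> simp
    rw [Finset.sum_congr rfl fun x _ => this x, Finset.sum_comm]
    refine Finset.sum_congr rfl fun c _ => ?_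
    split_ifs <;> simp
  have htot : ε * (n * G.winProbOn F S - N ^ S.card * (C * √n)) ≤
      ∑ i, (G.winProbOn F S - G.winProbOn F (insert i S)) := by
    have e1 : G.winProbOn F S = ∑ c : S → ∀ j, X j × A j,
        if ∀ l, G.V (fun j => (c l j).1) (fun j => (c l j).2) = true then
          ∑ x : (∀ j, Fin n → X j), (∏ l, G.Q (fun j => x j l)) *
            (∏ j, transcriptIndicator F S c j (x j)) else 0 := by
      have := hwin fun _ => 1
      simp only [mul_one] at this
      rw [← this]
      rfl
    have e2 : N ^ S.card * (C * √n) = ∑ _c : S → ∀ j, X j × A j, C * √n := by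
      simp [N]
    have e3 : ∑ i, (G.winProbOn F S - G.winProbOn F (insert i S)) =
        ∑ c : S → ∀ j, X j × A j,
        if ∀ l, G.V (fun j => (c l j).1) (fun j => (c l j).2) = true then
          ∑ i, ∑ x : (∀ j, Fin n → X j), (∏ l, G.Q (fun j => x j l)) *
            ((∏ j, transcriptIndicator F S c j (x j)) *
              G.loss (fun j => x j i) (fun j => F j (x j) i)) else 0 := by
      calc _ = ∑ i, ∑ c : S → ∀ j, X j × A j,
            if ∀ l, G.V (fun j => (c l j).1) (fun j => (c l j).2) = true then
              ∑ x : (∀ j, Fin n → X j), (∏ l, G.Q (fun j => x j l)) *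
                ((∏ j, transcriptIndicator F S c j (x j)) *
                  G.loss (fun j => x j i) (fun j => F j (x j) i)) else 0 := by
            refine Finset.sum_congr rfl fun i _ => ?_
            rw [G.winProbOn_insert, ← hwin fun x => G.loss (fun j => x j i) (fun j => F j (x j) i)]
        _ = _ := by
            rw [Finset.sum_comm]
            refine Finset.sum_congr rfl fun c _ => ?_
            split_ifs <;> simp
    rw [e3, e2]
    nth_rewrite 1 [e1]
    rw [Finset.mul_sum, ← Finset.sum_sub_distrib, Finset.mul_sum]
    refine Finset.sum_le_sum fun c _ => ?_
    split_ifs with hc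
    · refine h n hn F (fun j => transcriptIndicator F S c j) (fun j x => ?_) (fun j x => ?_) <;>
      · unfold transcriptIndicator
        split_ifs <;> norm_num
    -- Losing transcripts contribute no mass; counting their error term too only weakens the bound.
    · have : 0 ≤ ε * (C * √n) := by positivity
      linarith
  -- Averaging over all `n` coordinates. The coordinate found may already lie in `S`, which is
  -- harmless.
  by_contra! hno
  have hlt : ∑ i, (G.winProbOn F S - G.winProbOn F (insert i S)) <
      ∑ _i : Fin n, (ε * G.winProbOn F S - ε * C * N ^ S.card / √n) := by
    have : Nonempty (Fin n) := ⟨⟨0, hn⟩⟩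
    refine Finset.sum_lt_sum_of_nonempty Finset.univ_nonempty fun i _ => ?_
    have := hno i
    linarith
  rw [Finset.sum_const, Finset.card_univ, Fintype.card_fin, nsmul_eq_mul] at hlt
  have e4 : (n : ℝ) * (ε * G.winProbOn F S - ε * C * N ^ S.card / √n) =
      ε * (n * G.winProbOn F S - N ^ S.card * (C * √n)) := by
    have : (n : ℝ) / √n = √n := Real.div_sqrt
    calc _ = ε * (n * G.winProbOn F S - N ^ S.card * (C * (n / √n))) := by ring
      _ = _ := by rw [this]
  linarith

theorem exists_winProbOn_le [∀ j, Fintype (A j)] (G : MultiplayerGame k X A)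
    (hconn : G.PlayerwiseConnected) (hval : G.value < 1) :
    ∃ C : ℝ, 0 ≤ C ∧ ∃ N : ℕ, 2 ≤ N ∧ ∀ n : ℕ, 1 ≤ n →
      ∀ (F : ∀ j, (Fin n → X j) → Fin n → A j) (m : ℕ), ∃ S, G.winProbOn F S ≤
        (1 - (1 - G.value) / 2 ^ k) ^ m + C * (N : ℝ) ^ m / √n := by
  obtain ⟨C, hC, h⟩ := G.exists_winProbOn_insert_le hconn hval
  -- The `+ 2` ensures `2 ≤ N`, so that the at most doubled error of each round is absorbed by one
  -- further factor `N`.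
  set N := Fintype.card (∀ j, X j × A j) + 2
  have hε1 : (1 - G.value) / 2 ^ k ≤ 1 := by
    rw [div_le_one (by positivity)]
    have : (1 : ℝ) ≤ 2 ^ k := one_le_pow₀ one_le_two
    linarith [G.value_nonneg]
  have hε0 : 0 ≤ (1 - G.value) / 2 ^ k := div_nonneg (by linarith) (by positivity)
  set ε := (1 - G.value) / 2 ^ k
  refine ⟨C, hC, N, Nat.le_add_left _ _, fun n hn F m => ?_⟩
  suffices ∃ S : Finset (Fin n), S.card ≤ m ∧
      G.winProbOn F S ≤ (1 - ε) ^ m + C * (N : ℝ) ^ m / √n from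
    let ⟨S, hS⟩ := this; ⟨S, hS.2⟩
  have hN2 : (2 : ℝ) ≤ N := by exact_mod_cast Nat.le_add_left 2 _
  induction m with
  | zero =>
    refine ⟨∅, by simp, ?_⟩
    rw [G.winProbOn_empty, pow_zero]
    have : 0 ≤ C * (N : ℝ) ^ 0 / √n := by positivity
    linarith
  | succ m ih =>
    obtain ⟨S, hS, hw⟩ := ih
    obtain ⟨i, hi⟩ := h n hn F S
    refine ⟨insert i S, (Finset.card_insert_le _ _).trans (by omega), hi.trans ?_⟩
    have h1 : (Fintype.card (∀ j, X j × A j) : ℝ) ^ S.card ≤ (N : ℝ) ^ m := by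
      calc _ ≤ (N : ℝ) ^ S.card := pow_le_pow_left₀ (Nat.cast_nonneg _)
            (by exact_mod_cast Nat.le_add_right _ 2) _
        _ ≤ _ := pow_le_pow_right₀ (by linarith) hS
    have h2 : C * (Fintype.card (∀ j, X j × A j) : ℝ) ^ S.card / √n ≤ C * (N : ℝ) ^ m / √n :=
      div_le_div_of_nonneg_right (mul_le_mul_of_nonneg_left h1 hC) (Real.sqrt_nonneg _)
    have h3 : 0 ≤ C * (N : ℝ) ^ m / √n := by positivity
    calc _ ≤ (1 - ε) * ((1 - ε) ^ m + C * (N : ℝ) ^ m / √n) + C * (N : ℝ) ^ m / √n :=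
          add_le_add (mul_le_mul_of_nonneg_left hw (by linarith)) h2
      _ ≤ (1 - ε) ^ (m + 1) + 2 * (C * (N : ℝ) ^ m / √n) := by
          rw [pow_succ]; nlinarith
      _ ≤ (1 - ε) ^ (m + 1) + N * (C * (N : ℝ) ^ m / √n) := by
          have := mul_le_mul_of_nonneg_right hN2 h3
          linarith
      _ = _ := by rw [pow_succ (N : ℝ)]; ring

end MultiplayerGame

/-! ### From iterated conditioning to polynomial decay -/

/-- Choosing the number of rounds logarithmically: a geometric decay with an error that grows
geometrically, but is of order `1 / √n`, gives polynomial decay. -/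
theorem exists_rpow_bound {ρ β C : ℝ} (hρ0 : 0 < ρ) (hρ1 : ρ < 1) (hβ0 : 0 < β) (hβ1 : β < 1)
    (hC : 0 ≤ C) {N : ℕ} (hN : 2 ≤ N) : ∃ c : ℝ, 0 < c ∧ ∀ n : ℕ, 1 ≤ n → ∀ v : ℝ, 0 ≤ v →
      v ≤ β → (∀ m : ℕ, v ≤ ρ ^ m + C * (N : ℝ) ^ m / √n) → v ≤ (n : ℝ) ^ (-c) := by
  have hN1 : (1 : ℝ) < N := by exact_mod_cast hN
  have hlogN : 0 < Real.log N := Real.log_pos hN1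
  have hlogρ : Real.log ρ < 0 := Real.log_neg hρ0 hρ1
  have hlogβ : Real.log β < 0 := Real.log_neg hβ0 hβ1
  -- With about `log n / (4 * log N)` rounds, `ρ ^ m` is of order `n ^ (-a)`, while `N ^ m ≤ n ^ (1
  -- / 4)` leaves an error of order `n ^ (-1 / 4)`.
  set a := -Real.log ρ / (4 * Real.log N) with ha
  have ha0 : 0 < a := div_pos (by linarith) (by positivity)
  set d := min a (1 / 4) with hd
  have hd0 : 0 < d := lt_min ha0 (by norm_num)
  -- The factor `ρ⁻¹` pays for rounding the number of rounds down.
  set K := ρ⁻¹ + C with hK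
  have hK1 : 1 < K := by
    have : 1 < ρ⁻¹ := (one_lt_inv₀ hρ0).2 hρ1
    linarith
  have hlogK : 0 < Real.log K := Real.log_pos hK1
  -- Solves `β ^ (1 - θ) * K ^ θ = 1`, so interpolating between `v ≤ β` and `v ≤ K * n ^ (-d)`
  -- removes the constant `K`, also for small `n`.
  set θ := -Real.log β / (Real.log K - Real.log β) with hθ
  have hθ0 : 0 < θ := div_pos (by linarith) (by linarith)
  have hθ1 : θ < 1 := by rw [hθ, div_lt_one (by linarith)]; linarith
  refine ⟨d * θ, by positivity, fun n hn v hv hvβ hm => ?_⟩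
  have hn1 : (1 : ℝ) ≤ n := by exact_mod_cast hn
  have hn0 : (0 : ℝ) < n := by linarith
  have hL : 0 ≤ Real.log n := Real.log_nonneg hn1
  have hbound : v ≤ K * (n : ℝ) ^ (-d) := by
    set m := ⌊Real.log n / (4 * Real.log N)⌋₊ with hmdef
    have hm1 : (m : ℝ) ≤ Real.log n / (4 * Real.log N) := Nat.floor_le (by positivity)
    have hm2 : Real.log n / (4 * Real.log N) < m + 1 := Nat.lt_floor_add_one _
    have e1 : ρ ^ m ≤ ρ⁻¹ * (n : ℝ) ^ (-d) := by
      have : ρ ^ (m + 1) ≤ (n : ℝ) ^ (-d) := by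
        rw [← Real.rpow_natCast, Real.rpow_def_of_pos hρ0, Real.rpow_def_of_pos hn0,
          Real.exp_le_exp]
        have h1 : d * Real.log n ≤ a * Real.log n :=
          mul_le_mul_of_nonneg_right (min_le_left _ _) hL
        have h2 : a * Real.log n = -Real.log ρ * (Real.log n / (4 * Real.log N)) := by
          rw [ha]; ring
        have h3 := mul_le_mul_of_nonneg_left hm2.le (show 0 ≤ -Real.log ρ by linarith)
        push_cast
        linarith
      calc ρ ^ m = ρ⁻¹ * ρ ^ (m + 1) := by rw [pow_succ]; field_simp
        _ ≤ _ := mul_le_mul_of_nonneg_left this (inv_nonneg.2 hρ0.le)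
    have e2 : (N : ℝ) ^ m / √n ≤ (n : ℝ) ^ (-d) := by
      rw [Real.sqrt_eq_rpow, div_eq_mul_inv, ← Real.rpow_neg hn0.le, ← Real.rpow_natCast,
        Real.rpow_def_of_pos (by linarith), Real.rpow_def_of_pos hn0, Real.rpow_def_of_pos hn0,
        ← Real.exp_add, Real.exp_le_exp]
      have h1 : d * Real.log n ≤ 1 / 4 * Real.log n :=
        mul_le_mul_of_nonneg_right (min_le_right _ _) hL
      have h2 : Real.log N * m ≤ Real.log n / 4 := by
        have := mul_le_mul_of_nonneg_left hm1 hlogN.le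
        have h4 : Real.log N * (Real.log n / (4 * Real.log N)) = Real.log n / 4 := by field_simp
        linarith
      linarith
    calc v ≤ ρ ^ m + C * (N : ℝ) ^ m / √n := hm m
      _ = ρ ^ m + C * ((N : ℝ) ^ m / √n) := by ring
      _ ≤ ρ⁻¹ * (n : ℝ) ^ (-d) + C * (n : ℝ) ^ (-d) :=
          add_le_add e1 (mul_le_mul_of_nonneg_left e2 hC)
      _ = _ := by rw [hK]; ring
  rcases hv.eq_or_lt with hv0 | hv0
  · rw [← hv0]; positivity
  rw [← Real.log_le_log_iff hv0 (by positivity), Real.log_rpow hn0]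
  have l1 : Real.log v ≤ Real.log β := Real.log_le_log hv0 hvβ
  have l2 : Real.log v ≤ Real.log K - d * Real.log n := by
    have := Real.log_le_log hv0 hbound
    rw [Real.log_mul (by linarith) (by positivity), Real.log_rpow hn0] at this
    linarith
  have l3 : (1 - θ) * Real.log β + θ * Real.log K = 0 := by
    have : Real.log K - Real.log β ≠ 0 := by linarith
    rw [hθ]
    field_simp
    ring
  nlinarith [mul_le_mul_of_nonneg_left l1 (sub_nonneg.2 hθ1.le),
    mul_le_mul_of_nonneg_left l2 hθ0.le]

open MultiplayerGame in
theorem mainTheorem3 {k : ℕ} {X : Fin k → Type u} {A : Fin k → Type v}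
    [∀ j, Fintype (X j)] [∀ j, Fintype (A j)]
    (G : MultiplayerGame k X A) (hconn : G.PlayerwiseConnected) (hval : G.value < 1) :
    ∃ c : ℝ, 0 < c ∧ ∀ n : ℕ, 1 ≤ n → (G.parallelRep n).value ≤ (n : ℝ) ^ (-c) := by
  obtain ⟨C, hC, N, hN, h⟩ := G.exists_winProbOn_le hconn hval
  have hε0 : 0 < (1 - G.value) / 2 ^ k := div_pos (by linarith) (by positivity)
  have hε1 : (1 - G.value) / 2 ^ k ≤ 1 := by
    rw [div_le_one (by positivity)]
    have : (1 : ℝ) ≤ 2 ^ k := one_le_pow₀ one_le_two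
    linarith [G.value_nonneg]
  -- The maxima with `1 / 2` keep both bases positive when the value, or `1 - (1 - G.value) / 2 ^
  -- k`, is zero.
  obtain ⟨c, hc, hbound⟩ := exists_rpow_bound
    (ρ := max (1 - (1 - G.value) / 2 ^ k) (1 / 2)) (β := max G.value (1 / 2))
    (lt_max_of_lt_right (by norm_num)) (max_lt (by linarith) (by norm_num))
    (lt_max_of_lt_right (by norm_num)) (max_lt hval (by norm_num)) hC hN
  refine ⟨c, hc, fun n hn => Real.iSup_le (fun F => ?_) (by positivity)⟩
  rw [winProb_parallelRep]
  refine hbound n hn _ (G.winProbOn_nonneg F univ) ?_ fun m => ?_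
  · exact ((G.winProbOn_anti F (Finset.subset_univ {⟨0, hn⟩})).trans
      (G.winProbOn_singleton_le F _)).trans (le_max_left _ _)
  · obtain ⟨S, hS⟩ := h n hn F m
    refine ((G.winProbOn_anti F (Finset.subset_univ S)).trans hS).trans ?_
    exact add_le_add (pow_le_pow_left₀ (by linarith) (le_max_left _ _) _) le_rfl
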